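/- Let $m\ge 1$, $n_1,n_2\ge 0$, $k_1,k_2\ge 0$ be integers and let $r_1,r_2>0$ satisfy $r_1^2+r_2^2=1$. Write $\mathbb S^n(r)$ for the sphere of radius $r$ centred at the origin of $\mathbb R^{n+1}$ with the induced Riemannian metric, and $\mathbb S^n=\mathbb S^n(1)$. A form of degree $k$ is a map $F:\mathbb R^{m+1}\to\mathbb R^{n+1}$ each of whose components is a homogeneous polynomial of degree $k$ or zero. For $i=1,2$ let $F_i:\mathbb R^{m+1}\to\mathbb R^{n_i+1}$ be a form of degree $k_i$ that maps $\mathbb S^m$ into $\mathbb S^{n_i}(r_i)$, and let $\varphi_i:\mathbb S^m\to\mathbb S^{n_i}(r_i)$ be its restriction. Suppose that $F_i$ is of minimal degree in its class, i.e. every form $G:\mathbb R^{m+1}\to\mathbb R^{n_i+1}$ (of any degree $l\ge 0$) with $G|_{\mathbb S^m}=F_i|_{\mathbb S^m}$ has degree $l\ge k_i$. Suppose also that $\varphi_1$ and $\varphi_2$ are harmonic. Consider the diagonal map $$\varphi:\mathbb S^m\to\mathbb S^{n_1+n_2+1},\qquad \varphi(x)=(\varphi_1(x),\varphi_2(x)).$$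 Then $\varphi$ is proper biharmonic if and only if $k_1\neq k_2$ and $r_1=r_2=\tfrac1{\sqrt2}$. Here a smooth map $\phi$ between Riemannian manifolds is harmonic if its tension field $\tau(\phi)=\operatorname{trace}\nabla d\phi$ vanishes, biharmonic if its bitension field $$\tau_2(\phi)=-\Delta\tau(\phi)-\operatorname{trace}R\big(d\phi(\cdot),\tau(\phi)\big)d\phi(\cdot)$$ vanishes, where $\Delta=-\operatorname{trace}\nabla^2$ is the rough Laplacian on sections of $\phi^{-1}TN$ and $R(X,Y)Z=\nabla_X\nabla_YZ-\nabla_Y\nabla_XZ-\nabla_{[X,Y]}Z$ is the curvature tensor of the target $N$, and proper biharmonic if it is biharmonic but not harmonic. -/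

import Mathlib

open Metric
open scoped ContDiff InnerProductSpace

noncomputable section

namespace SphereMaps

section Geometry

variable {E F G : Type*}
  [NormedAddCommGroup E] [InnerProductSpace ℝ E]
  [NormedAddCommGroup F] [InnerProductSpace ℝ F]
  [NormedAddCommGroup G] [NormedSpace ℝ G]
  {R r : ℝ}

open Classical in
/-- The extension of a map `σ`, defined on the sphere of radius `R`, that is constant along rays:
`y ↦ σ (R y / ‖y‖)` for `y ≠ 0` (the value at the origin plays no role). -/
def radialExt (σ : sphere (0 : E) R → G) (y : E) : G :=
  if h : (R / ‖y‖) • y ∈ sphere (0 : E) R then σ ⟨(R / ‖y‖) • y, h⟩ else 0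

/-- A map on the sphere is smooth if its radially constant extension is smooth off the origin. -/
def IsSmooth (σ : sphere (0 : E) R → G) : Prop :=
  ContDiffOn ℝ ∞ (radialExt σ) {0}ᶜ

/-- The derivative at `x`, in the direction of the tangent vector `v`, of a vector-valued map on
the sphere. It does not depend on how the map is extended, since `v` is tangent. -/
def sphDeriv (σ : sphere (0 : E) R → G) (x : sphere (0 : E) R) (v : E) : G :=
  fderiv ℝ (radialExt σ) (x : E) v

/-- The tangent space of the sphere at `p`, as a subspace of the ambient space. -/
def tangent (p : sphere (0 : E) R) : Submodule ℝ E := (Submodule.span ℝ {(p : E)})ᗮ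

/-- The orthogonal projection of the ambient space onto the tangent space at `p`. -/
def tanProj (p : sphere (0 : E) R) (w : E) : E :=
  (Submodule.span ℝ {(p : E)})ᗮ.starProjection w

/-- The tangent vector field `y ↦ tanProj y v`; it has the value `v` at every point where `v`
is tangent, so it extends a tangent vector to a smooth tangent vector field. -/
def tanField (v : E) (y : sphere (0 : E) R) : E := tanProj y v

/-- The connection on the pull-back bundle `φ⁻¹ T S(r)` of a map `φ : S(R) → S(r)`, where `S(r)`
has the Levi-Civita connection of the metric induced by the ambient Euclidean space: the covariant
derivative `∇_X σ` of a section `σ` along a vector field `X` of `S(R)` is the tangential part of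
the derivative of `σ`. -/
def covAlong (φ : sphere (0 : E) R → sphere (0 : F) r) (X : sphere (0 : E) R → E)
    (σ : sphere (0 : E) R → F) (x : sphere (0 : E) R) : F :=
  tanProj (φ x) (sphDeriv σ x (X x))

/-- The Levi-Civita connection `∇_X Y` of the sphere. -/
def leviCivita (X Y : sphere (0 : E) R → E) : sphere (0 : E) R → E :=
  covAlong id X Y

/-- The Lie bracket `[X, Y]` of tangent vector fields of the sphere. -/
def lieBracket (X Y : sphere (0 : E) R → E) (x : sphere (0 : E) R) : E :=
  sphDeriv Y x (X x) - sphDeriv X x (Y x)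

/-- The curvature tensor of the sphere,
`R(X, Y) Z = ∇_X ∇_Y Z - ∇_Y ∇_X Z - ∇_[X, Y] Z`, at `p` on the tangent vectors `u v w`. -/
def curvature (p : sphere (0 : F) r) (u v w : F) : F :=
  leviCivita (tanField u) (leviCivita (tanField v) (tanField w)) p
    - leviCivita (tanField v) (leviCivita (tanField u) (tanField w)) p
    - leviCivita (lieBracket (tanField u) (tanField v)) (tanField w) p

/-- The section `dφ(X)` of the pull-back bundle, for a vector field `X` of the domain. -/
def pushField (φ : sphere (0 : E) R → sphere (0 : F) r) (X : sphere (0 : E) R → E)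
    (x : sphere (0 : E) R) : F :=
  sphDeriv (fun y => (φ y : F)) x (X x)

/-- The second fundamental form `(∇dφ)(X, Y) = ∇_X (dφ(Y)) - dφ(∇_X Y)`. -/
def secondForm (φ : sphere (0 : E) R → sphere (0 : F) r) (X Y : sphere (0 : E) R → E)
    (x : sphere (0 : E) R) : F :=
  covAlong φ X (pushField φ Y) x - pushField φ (leviCivita X Y) x

/-- The second covariant derivative
`(∇²σ)(X, Y) = ∇_X ∇_Y σ - ∇_(∇_X Y) σ` of a section of the pull-back bundle. -/
def covSecond (φ : sphere (0 : E) R → sphere (0 : F) r) (X Y : sphere (0 : E) R → E)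
    (σ : sphere (0 : E) R → F) (x : sphere (0 : E) R) : F :=
  covAlong φ X (covAlong φ Y σ) x - covAlong φ (leviCivita X Y) σ x

variable [FiniteDimensional ℝ E]

/-- The vector field `tanField (e i)`, where `e` is an orthonormal basis of the tangent
space at `x`. -/
def frame (x : sphere (0 : E) R) (i : Fin (Module.finrank ℝ (tangent x))) :
    sphere (0 : E) R → E :=
  tanField ((stdOrthonormalBasis ℝ (tangent x) i : tangent x) : E)

/-- The tension field `τ(φ) = trace ∇dφ`. -/
def tension (φ : sphere (0 : E) R → sphere (0 : F) r) (x : sphere (0 : E) R) : F :=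
  ∑ i, secondForm φ (frame x i) (frame x i) x

/-- The rough Laplacian `Δσ = - trace ∇²σ` on sections of the pull-back bundle. -/
def roughLaplacian (φ : sphere (0 : E) R → sphere (0 : F) r) (σ : sphere (0 : E) R → F)
    (x : sphere (0 : E) R) : F :=
  -∑ i, covSecond φ (frame x i) (frame x i) σ x

/-- The bitension field `τ₂(φ) = - Δ τ(φ) - trace R(dφ ·, τ(φ)) dφ ·`. -/
def bitension (φ : sphere (0 : E) R → sphere (0 : F) r) (x : sphere (0 : E) R) : F :=
  -roughLaplacian φ (tension φ) x
    - ∑ i, curvature (φ x) (pushField φ (frame x i) x) (tension φ x) (pushField φ (frame x i) x)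

/-- Harmonic maps between spheres: smooth maps with vanishing tension field. -/
def IsHarmonic (φ : sphere (0 : E) R → sphere (0 : F) r) : Prop :=
  IsSmooth (fun x => (φ x : F)) ∧ ∀ x, tension φ x = 0

/-- Biharmonic maps between spheres: smooth maps with vanishing bitension field. -/
def IsBiharmonic (φ : sphere (0 : E) R → sphere (0 : F) r) : Prop :=
  IsSmooth (fun x => (φ x : F)) ∧ ∀ x, bitension φ x = 0

/-- Proper biharmonic maps: biharmonic maps that are not harmonic. -/
def IsProperBiharmonic (φ : sphere (0 : E) R → sphere (0 : F) r) : Prop :=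
  IsBiharmonic φ ∧ ¬ IsHarmonic φ

end Geometry

/-- The diagonal map `x ↦ (φ₁ x, φ₂ x)`, composed with the inclusion
`S(r₁) × S(r₂) → S(1)` into the unit sphere of the Euclidean product of the ambient spaces. -/
def diagonalMap {X V₁ V₂ : Type*} [NormedAddCommGroup V₁] [InnerProductSpace ℝ V₁]
    [NormedAddCommGroup V₂] [InnerProductSpace ℝ V₂] {r₁ r₂ : ℝ} (hr : r₁ ^ 2 + r₂ ^ 2 = 1)
    (φ₁ : X → sphere (0 : V₁) r₁) (φ₂ : X → sphere (0 : V₂) r₂) (x : X) :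
    sphere (0 : WithLp 2 (V₁ × V₂)) 1 :=
  ⟨WithLp.toLp 2 ((φ₁ x : V₁), (φ₂ x : V₂)), by
    rw [mem_sphere_zero_iff_norm, WithLp.prod_norm_eq_of_L2]
    simp [hr]⟩

/-- The sphere `S^n(r)` of radius `r` in `ℝ^(n+1)`. -/
abbrev Sph (n : ℕ) (r : ℝ) : Type := sphere (0 : EuclideanSpace ℝ (Fin (n + 1))) r

/-- A tuple of polynomials whose components are homogeneous of degree `k` (or zero). -/
def IsForm {m n : ℕ} (k : ℕ) (F : Fin (n + 1) → MvPolynomial (Fin (m + 1)) ℝ) : Prop :=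
  ∀ i, (F i).IsHomogeneous k

/-- The polynomial map `ℝ^(m+1) → ℝ^(n+1)` given by a tuple of polynomials. -/
def evalForm {m n : ℕ} (F : Fin (n + 1) → MvPolynomial (Fin (m + 1)) ℝ)
    (x : EuclideanSpace ℝ (Fin (m + 1))) : EuclideanSpace ℝ (Fin (n + 1)) :=
  WithLp.toLp 2 (fun i => MvPolynomial.eval (fun j => x j) (F i))

/-- `F` restricts to the map `φ : S^m → S^n(r)`. -/
def RestrictsTo {m n : ℕ} {r : ℝ} (F : Fin (n + 1) → MvPolynomial (Fin (m + 1)) ℝ)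
    (φ : Sph m 1 → Sph n r) : Prop :=
  ∀ x : Sph m 1, evalForm F x = φ x

/-- `F` is a form of degree `k`, and `k` is the least degree of a form with the same restriction
to the unit sphere. -/
def IsFormOfMinimalDegree {m n : ℕ} (k : ℕ)
    (F : Fin (n + 1) → MvPolynomial (Fin (m + 1)) ℝ) : Prop :=
  IsForm k F ∧ ∀ (l : ℕ) (G : Fin (n + 1) → MvPolynomial (Fin (m + 1)) ℝ), IsForm l G →
    (∀ x : Sph m 1, evalForm G x = evalForm F x) → k ≤ l

end SphereMaps

end

noncomputable section

namespace SphereMaps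

/-! ### Differential calculus on the unit sphere through ambient extensions. -/

section Calculus

variable {E F G : Type*}
  [NormedAddCommGroup E] [InnerProductSpace ℝ E]
  [NormedAddCommGroup F] [InnerProductSpace ℝ F]
  [NormedAddCommGroup G] [NormedSpace ℝ G]
  {r : ℝ}

/-! If `f` is a smooth ambient extension of `φ`, then `τ(φ)` is the tangential part of the spherical
Laplacian of `f` (`tension_eq`), and the unit sphere has curvature one (`curvature_eq`). So
everything reduces to Laplacians of extensions.

Let `F` be one of the two forms, `k` its degree, `r` the radius, `L` its Euclidean Laplacian and `Q
= X₀² + ⋯ + X_m²`. Harmonicity says that `L` is parallel to `F` on the sphere: `r² L = ⟨F, L⟩ F`.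
Homogenizing gives `r² Q^k L = A F` with `A = ∑ L_j F_j`. Minimality of `k` means that `Q` does not
divide all components of `F`; as `Q` is prime, `Q^k` divides `A`. For `k ≥ 1` the degree of `A` is
too small, so `A = 0` and `L = 0` (`eq_zero_of_parallel`); constants are trivial. Hence `φᵢ` is an
eigenmap with eigenvalue `lᵢ = kᵢ (kᵢ + m - 1)`.

All sections that occur for the diagonal map are then `(a φ₁, b φ₂)` with constant `a`, `b`. One
finds `τ = (l₂ - l₁) (r₂² φ₁, -r₁² φ₂)` and `τ₂ = (l₂ - l₁) (1 - 2 r₁²) τ`. Harmonic means `l₁ =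
l₂`, that is `k₁ = k₂`; otherwise biharmonic means `r₁² = 1/2`. -/

theorem tanProj_eq (p : sphere (0 : F) r) (w : F) :
    tanProj p w = w - (⟪(p : F), w⟫_ℝ / r ^ 2) • (p : F) := by
  rw [tanProj, Submodule.starProjection_orthogonal_val, Submodule.starProjection_singleton,
    mem_sphere_zero_iff_norm.1 p.2]
  rfl

theorem mem_tangent_iff (p : sphere (0 : F) r) (w : F) :
    w ∈ tangent p ↔ ⟪(p : F), w⟫_ℝ = 0 := Submodule.mem_orthogonal_singleton_iff_inner_right

theorem tanProj_of_inner_eq_zero (p : sphere (0 : F) r) {w : F} (h : ⟪(p : F), w⟫_ℝ = 0) :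
    tanProj p w = w := by
  simp [tanProj_eq, h]

theorem inner_tanProj (p : sphere (0 : F) r) (w : F) : ⟪(p : F), tanProj p w⟫_ℝ = 0 :=
  (mem_tangent_iff p _).1 (Submodule.starProjection_apply_mem (Submodule.span ℝ {(p : F)})ᗮ w)

theorem tanProj_add (p : sphere (0 : F) r) (v w : F) :
    tanProj p (v + w) = tanProj p v + tanProj p w := map_add _ _ _

theorem tanProj_sub (p : sphere (0 : F) r) (v w : F) :
    tanProj p (v - w) = tanProj p v - tanProj p w := map_sub _ _ _

theorem tanProj_smul (p : sphere (0 : F) r) (c : ℝ) (w : F) :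
    tanProj p (c • w) = c • tanProj p w := map_smul _ _ _

theorem tanProj_sum (p : sphere (0 : F) r) {ι : Type*} (s : Finset ι) (w : ι → F) :
    tanProj p (∑ i ∈ s, w i) = ∑ i ∈ s, tanProj p (w i) := map_sum _ _ _

theorem tanProj_self (hr : r ≠ 0) (p : sphere (0 : F) r) : tanProj p (p : F) = 0 := by
  rw [tanProj_eq, real_inner_self_eq_norm_sq, mem_sphere_zero_iff_norm.1 p.2,
    div_self (pow_ne_zero 2 hr), one_smul, sub_self]

theorem radialExt_eventuallyEq {H : Type*} [NormedAddCommGroup H]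
    {σ : sphere (0 : E) 1 → H} {g : E → H} (hσ : ∀ y, σ y = g y)
    {x : E} (hx : x ≠ 0) : radialExt σ =ᶠ[nhds x] fun y => g (‖y‖⁻¹ • y) := by
  filter_upwards [isOpen_compl_singleton.mem_nhds hx] with y hy
  have h : (1 / ‖y‖) • y ∈ sphere (0 : E) 1 := by
    rw [mem_sphere_zero_iff_norm, norm_smul, norm_div, norm_one, norm_norm]
    exact one_div_mul_cancel (norm_ne_zero_iff.2 hy)
  rw [radialExt, dif_pos h, hσ]
  simp only [one_div]

/-- The derivative of a map on the unit sphere along a tangent vector is that of any smooth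
extension. -/
theorem sphDeriv_eq_fderiv {σ : sphere (0 : E) 1 → G} {g : E → G} (hσ : ∀ y, σ y = g y)
    {x : sphere (0 : E) 1} (hg : DifferentiableAt ℝ g x) {v : E} (hv : ⟪(x : E), v⟫_ℝ = 0) :
    sphDeriv σ x v = fderiv ℝ g x v := by
  have hx1 : ‖(x : E)‖ = 1 := mem_sphere_zero_iff_norm.1 x.2
  have hx : (x : E) ≠ 0 := norm_ne_zero_iff.1 (by simp [hx1])
  rw [sphDeriv, (radialExt_eventuallyEq hσ hx).fderiv_eq]
  -- The retraction `y ↦ y / ‖y‖` is differentiated through `√(‖y‖²)`; at a unit vector its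
  -- derivative fixes tangent vectors.
  have hN : HasFDerivAt (fun y : E => (‖y‖ ^ 2)) (2 • innerSL ℝ (x : E)) x :=
    (hasStrictFDerivAt_norm_sq (x : E)).hasFDerivAt
  have hN' := (HasDerivAt.comp_hasFDerivAt (x : E) (hasDerivAt_inv (by simp [hx1]))
    (hN.sqrt (by simp [hx1]))).smul (hasFDerivAt_id (𝕜 := ℝ) (x : E))
  have hφ := hN'.congr_of_eventuallyEq (f₁ := fun y : E => ‖y‖⁻¹ • y)
    (Filter.Eventually.of_forall fun y => by simp)
  have hg' : HasFDerivAt g (fderiv ℝ g x) (‖(x : E)‖⁻¹ • (x : E)) := by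
    simpa [hx1] using hg.hasFDerivAt
  have hc := HasFDerivAt.comp (g := g) (f := fun y : E => ‖y‖⁻¹ • y) (x : E) hg' hφ
  rw [Function.comp_def] at hc
  rw [hc.fderiv]
  simp [hx1, hv]


theorem sphDeriv_zero (σ : sphere (0 : E) r → G) (x : sphere (0 : E) r) : sphDeriv σ x 0 = 0 :=
  map_zero _

theorem covAlong_of_eq_zero {R : ℝ} (φ : sphere (0 : E) R → sphere (0 : F) r)
    {X : sphere (0 : E) R → E} (σ : sphere (0 : E) R → F) {x : sphere (0 : E) R} (hX : X x = 0) :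
    covAlong φ X σ x = 0 := by
  rw [covAlong, hX, sphDeriv_zero]
  exact map_zero (Submodule.span ℝ {(φ x : F)})ᗮ.starProjection

theorem tanField_eq (v : E) (y : sphere (0 : E) 1) :
    tanField v y = v - ⟪(y : E), v⟫_ℝ • (y : E) := by
  simp [tanField, tanProj_eq]

theorem inner_tanField (v : E) (y : sphere (0 : E) r) : ⟪(y : E), tanField v y⟫_ℝ = 0 :=
  inner_tanProj _ _

theorem tanField_of_inner_eq_zero {v : E} {y : sphere (0 : E) r} (h : ⟪(y : E), v⟫_ℝ = 0) :
    tanField v y = v := tanProj_of_inner_eq_zero y h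

theorem hasFDerivAt_inner_smul (w x : E) :
    HasFDerivAt (fun z : E => ⟪z, w⟫_ℝ • z)
      (⟪x, w⟫_ℝ • ContinuousLinearMap.id ℝ E + (innerSL ℝ w).smulRight x) x := by
  have h : HasFDerivAt (fun z : E => ⟪z, w⟫_ℝ) (innerSL ℝ w) x := by
    refine (innerSL ℝ w).hasFDerivAt.congr_of_eventuallyEq (Filter.Eventually.of_forall fun z => ?_)
    simp [real_inner_comm]
  exact h.smul (hasFDerivAt_id x)

theorem sphDeriv_tanField (w : E) (x : sphere (0 : E) 1) {v : E} (hv : ⟪(x : E), v⟫_ℝ = 0) :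
    sphDeriv (tanField w) x v = -(⟪(x : E), w⟫_ℝ • v + ⟪w, v⟫_ℝ • (x : E)) := by
  have h := (hasFDerivAt_inner_smul w (x : E)).const_sub w
  rw [sphDeriv_eq_fderiv (tanField_eq w) h.differentiableAt hv, h.fderiv]
  simp

theorem leviCivita_tanField (v w : E) (y : sphere (0 : E) 1) :
    leviCivita (tanField v) (tanField w) y = -⟪(y : E), w⟫_ℝ • tanField v y := by
  have h := inner_tanField v y
  rw [leviCivita, covAlong, sphDeriv_tanField w y h, neg_add, tanProj_add, ← neg_smul, ← neg_smul,
    tanProj_smul, tanProj_smul, id, tanProj_self one_ne_zero, smul_zero, add_zero,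
    tanProj_of_inner_eq_zero _ h]

/-- The inner derivative is `-⟨y, w⟩` times the field of `v`. The factor `⟨y, w⟩` vanishes at `p`,
so only its derivative `⟨u, w⟩` survives there. -/
theorem leviCivita_leviCivita_tanField {u v w : E} {p : sphere (0 : E) 1}
    (hu : ⟪(p : E), u⟫_ℝ = 0) (hv : ⟪(p : E), v⟫_ℝ = 0) (hw : ⟪(p : E), w⟫_ℝ = 0) :
    leviCivita (tanField u) (leviCivita (tanField v) (tanField w)) p = -⟪u, w⟫_ℝ • v := by
  have e : ∀ y : sphere (0 : E) 1, leviCivita (tanField v) (tanField w) y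
      = (fun z : E => ⟪z, -w⟫_ℝ • (v - ⟪z, v⟫_ℝ • z)) y := fun y => by
    simp only [leviCivita_tanField, tanField_eq, inner_neg_right]
  have h1 : HasFDerivAt (fun z : E => ⟪z, -w⟫_ℝ) (innerSL ℝ (-w)) (p : E) := by
    refine (innerSL ℝ (-w)).hasFDerivAt.congr_of_eventuallyEq
      (Filter.Eventually.of_forall fun z => ?_)
    simp [real_inner_comm]
  have h := h1.smul ((hasFDerivAt_inner_smul v (p : E)).const_sub v)
  rw [leviCivita, covAlong, tanField_of_inner_eq_zero hu, sphDeriv_eq_fderiv e h.differentiableAt hu,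
    HasFDerivAt.fderiv h, id]
  simp only [hv, hw, inner_neg_right,
    ContinuousLinearMap.smulRight_apply, innerSL_apply_apply, inner_neg_left, zero_smul, sub_zero, neg_zero,
    zero_add]
  rw [tanProj_smul, tanProj_of_inner_eq_zero p hv, real_inner_comm]

/-- The unit sphere has constant curvature one. -/
theorem curvature_eq {u v w : E} {p : sphere (0 : E) 1}
    (hu : ⟪(p : E), u⟫_ℝ = 0) (hv : ⟪(p : E), v⟫_ℝ = 0) (hw : ⟪(p : E), w⟫_ℝ = 0) :
    curvature p u v w = ⟪v, w⟫_ℝ • u - ⟪u, w⟫_ℝ • v := by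
  have hb : lieBracket (tanField u) (tanField v) p = 0 := by
    rw [lieBracket, tanField_of_inner_eq_zero hu, tanField_of_inner_eq_zero hv,
      sphDeriv_tanField v p hu, sphDeriv_tanField u p hv, hu, hv, real_inner_comm, zero_smul,
      zero_smul, sub_self]
  rw [curvature, leviCivita_leviCivita_tanField hu hv hw, leviCivita_leviCivita_tanField hv hu hw,
    leviCivita, covAlong_of_eq_zero _ _ hb]
  module

section

variable {φ : sphere (0 : E) 1 → sphere (0 : F) r} {f s : E → F}

theorem hasFDerivAt_fderiv_tanField {f : E → G} (hf : ContDiff ℝ ∞ f) (e x : E) :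
    HasFDerivAt (fun y => fderiv ℝ f y (e - ⟪y, e⟫_ℝ • y))
      ((fderiv ℝ f x).comp
          (-(⟪x, e⟫_ℝ • ContinuousLinearMap.id ℝ E + (innerSL ℝ e).smulRight x))
        + (fderiv ℝ (fderiv ℝ f) x).flip (e - ⟪x, e⟫_ℝ • x)) x := by
  have h2 : ContDiff ℝ ∞ (fderiv ℝ f) := hf.fderiv_right (by simp)
  exact ((h2.differentiable (by simp)) x).hasFDerivAt.clm_apply
    ((hasFDerivAt_inner_smul e x).const_sub e)

/-- The term `-df(x)` appears because `tanField e` has derivative `-x` at `x` in the unit direction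
`e`. -/
theorem sphDeriv_sphDeriv_tanField {f : E → G} {σ : sphere (0 : E) 1 → G} (hσ : ∀ y, σ y = f y)
    (hf : ContDiff ℝ ∞ f) {x : sphere (0 : E) 1} {e : E} (he : ⟪(x : E), e⟫_ℝ = 0)
    (he1 : ‖e‖ = 1) :
    sphDeriv (fun y => sphDeriv σ y (tanField e y)) x e
      = fderiv ℝ (fderiv ℝ f) x e e - fderiv ℝ f x x := by
  have h := hasFDerivAt_fderiv_tanField hf e x
  have e1 : ∀ y : sphere (0 : E) 1, sphDeriv σ y (tanField e y)
      = (fun y => fderiv ℝ f y (e - ⟪y, e⟫_ℝ • y)) y := fun y => by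
    rw [sphDeriv_eq_fderiv hσ (hf.differentiable (by simp) _) (inner_tanField e y), tanField_eq]
  rw [sphDeriv_eq_fderiv e1 h.differentiableAt he, HasFDerivAt.fderiv h]
  simp [he, he1]
  abel

/-- This removes the correction terms in `∇_(∇_X X)` from both second-order operators. -/
theorem leviCivita_tanField_self {e : E} {x : sphere (0 : E) 1} (he : ⟪(x : E), e⟫_ℝ = 0) :
    leviCivita (tanField e) (tanField e) x = 0 := by
  rw [leviCivita_tanField, he, neg_zero, zero_smul]

theorem secondForm_tanField (hφ : ∀ y, (φ y : F) = f y) (hf : ContDiff ℝ ∞ f)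
    {x : sphere (0 : E) 1} {e : E} (he : ⟪(x : E), e⟫_ℝ = 0) (he1 : ‖e‖ = 1) :
    secondForm φ (tanField e) (tanField e) x
      = tanProj (φ x) (fderiv ℝ (fderiv ℝ f) x e e - fderiv ℝ f x x) := by
  rw [secondForm, pushField, leviCivita_tanField_self he, sphDeriv_zero, sub_zero, covAlong,
    tanField_of_inner_eq_zero he]
  exact congrArg _ (sphDeriv_sphDeriv_tanField hφ hf he he1)

theorem covSecond_tanField (hr : r ≠ 0) (hφ : ∀ y, (φ y : F) = f y) (hf : ContDiff ℝ ∞ f)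
    {σ : sphere (0 : E) 1 → F} (hσ : ∀ y, σ y = s y) (hs : ContDiff ℝ ∞ s)
    {x : sphere (0 : E) 1} {e : E} (he : ⟪(x : E), e⟫_ℝ = 0) (he1 : ‖e‖ = 1)
    (hfs : ⟪f x, fderiv ℝ s x e⟫_ℝ = 0) :
    covSecond φ (tanField e) (tanField e) σ x
      = tanProj (φ x) (fderiv ℝ (fderiv ℝ s) x e e - fderiv ℝ s x x) := by
  have h := hasFDerivAt_fderiv_tanField hs e (x : E)
  have hfx := (hf.differentiable (by simp) (x : E)).hasFDerivAt
  have h' := h.sub (((hfx.inner ℝ h).mul_const (r ^ 2)⁻¹).smul hfx)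
  have e1 : ∀ y : sphere (0 : E) 1, covAlong φ (tanField e) σ y
      = ((fun y => fderiv ℝ s y (e - ⟪y, e⟫_ℝ • y)) - (fun y =>
        ⟪f y, fderiv ℝ s y (e - ⟪y, e⟫_ℝ • y)⟫_ℝ * (r ^ 2)⁻¹) • f) y := fun y => by
    rw [covAlong, sphDeriv_eq_fderiv hσ (hs.differentiable (by simp) _) (inner_tanField e y),
      tanField_eq, tanProj_eq, hφ]
    rfl
  rw [covSecond, covAlong_of_eq_zero _ _ (leviCivita_tanField_self he), sub_zero, covAlong,
    tanField_of_inner_eq_zero he, sphDeriv_eq_fderiv e1 h'.differentiableAt he, HasFDerivAt.fderiv h']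
  -- The normal part subtracted in `∇_e σ` is a coefficient times `f`. Differentiating the
  -- coefficient leaves a multiple of `f x`, which projects to zero; differentiating `f` leaves the
  -- coefficient at `x`, which is zero by `hfs`.
  have key : ∀ (a : F) (c d : ℝ) (b : F), d = 0 →
      tanProj (φ x) (a - (d • b + c • f x)) = tanProj (φ x) a := by
    rintro a c d b rfl
    rw [zero_smul, zero_add, tanProj_sub, tanProj_smul, ← hφ, tanProj_self hr, smul_zero, sub_zero]
  simp only [sub_apply, add_apply, smul_apply, ContinuousLinearMap.smulRight_apply]
  rw [key _ _ _ _ (by simp [he, hfs])]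
  congr 1
  simp [he, he1]
  abel

variable [FiniteDimensional ℝ E]

/-- The Laplacian of the unit sphere, at `x`, of the restriction of `f` to the sphere. -/
def sphLaplacian (f : E → G) (x : sphere (0 : E) 1) : G :=
  ∑ i, (fderiv ℝ (fderiv ℝ f) x (stdOrthonormalBasis ℝ (tangent x) i : tangent x)
    (stdOrthonormalBasis ℝ (tangent x) i : tangent x) - fderiv ℝ f x x)

theorem inner_basis (x : sphere (0 : E) r) (i) :
    ⟪(x : E), (stdOrthonormalBasis ℝ (tangent x) i : tangent x)⟫_ℝ = 0 :=
  (mem_tangent_iff x _).1 (stdOrthonormalBasis ℝ (tangent x) i).2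

theorem norm_basis (x : sphere (0 : E) r) (i) :
    ‖((stdOrthonormalBasis ℝ (tangent x) i : tangent x) : E)‖ = 1 :=
  (stdOrthonormalBasis ℝ (tangent x)).orthonormal.1 i

theorem tension_eq (hφ : ∀ y, (φ y : F) = f y) (hf : ContDiff ℝ ∞ f) (x : sphere (0 : E) 1) :
    tension φ x = tanProj (φ x) (sphLaplacian f x) := by
  rw [tension, sphLaplacian, tanProj_sum]
  exact Finset.sum_congr rfl fun i _ =>
    secondForm_tanField hφ hf (inner_basis x i) (norm_basis x i)

theorem roughLaplacian_eq (hr : r ≠ 0) (hφ : ∀ y, (φ y : F) = f y) (hf : ContDiff ℝ ∞ f)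
    {σ : sphere (0 : E) 1 → F} (hσ : ∀ y, σ y = s y) (hs : ContDiff ℝ ∞ s)
    (x : sphere (0 : E) 1)
    (hfs : ∀ e, ⟪(x : E), e⟫_ℝ = 0 → ⟪f x, fderiv ℝ s x e⟫_ℝ = 0) :
    roughLaplacian φ σ x = -tanProj (φ x) (sphLaplacian s x) := by
  rw [roughLaplacian, sphLaplacian, tanProj_sum]
  congr 1
  exact Finset.sum_congr rfl fun i _ =>
    covSecond_tanField hr hφ hf hσ hs (inner_basis x i) (norm_basis x i) (hfs _ (inner_basis x i))

theorem pushField_frame (hφ : ∀ y, (φ y : F) = f y) (hf : ContDiff ℝ ∞ f) (x : sphere (0 : E) 1)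
    (i) : pushField φ (frame x i) x = fderiv ℝ f x (stdOrthonormalBasis ℝ (tangent x) i : tangent x) := by
  rw [pushField, frame, tanField_of_inner_eq_zero (inner_basis x i),
    sphDeriv_eq_fderiv hφ (hf.differentiable (by simp) _) (inner_basis x i)]

end

end Calculus

/-! ### Divisibility of forms by the quadric `X₀² + ⋯ + X_m²`. -/

section Algebra

open MvPolynomial

/-- The polynomial `X₀² + ⋯ + X_m²`. -/
def normSqPoly (m : ℕ) : MvPolynomial (Fin (m + 1)) ℝ := ∑ j, X j ^ 2

theorem isHomogeneous_normSqPoly (m : ℕ) : (normSqPoly m).IsHomogeneous 2 :=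
  IsHomogeneous.sum _ _ _ fun j _ => isHomogeneous_X_pow j 2

theorem eval_normSqPoly {m : ℕ} (x : Sph m 1) :
    eval (fun j => (x : EuclideanSpace ℝ (Fin (m + 1))) j) (normSqPoly m) = 1 := by
  have h := EuclideanSpace.real_norm_sq_eq (x : EuclideanSpace ℝ (Fin (m + 1)))
  rw [mem_sphere_zero_iff_norm.1 x.2, one_pow] at h
  simp [normSqPoly, ← h]

/-- In at least two variables, the sum of the squares of the variables is a real prime. -/
theorem prime_normSqPoly {m : ℕ} (hm : 1 ≤ m) : Prime (normSqPoly m) := by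
  rw [← UniqueFactorizationMonoid.irreducible_iff_prime,
    ← MulEquiv.irreducible_iff (finSuccEquiv ℝ m)]
  set q : MvPolynomial (Fin m) ℝ := ∑ j, X j ^ 2 with hq
  have h : finSuccEquiv ℝ m (normSqPoly m) = Polynomial.X ^ 2 + Polynomial.C q := by
    rw [normSqPoly, Fin.sum_univ_succ, map_add, map_pow, finSuccEquiv_X_zero, map_sum, hq, map_sum]
    simp [finSuccEquiv_X_succ]
  rw [h]
  have hd : (Polynomial.X ^ 2 + Polynomial.C q).natDegree = 2 :=
    Polynomial.natDegree_X_pow_add_C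
  rw [Polynomial.Monic.irreducible_iff_roots_eq_zero_of_degree_le_three
    (Polynomial.monic_X_pow_add_C q two_ne_zero) hd.ge (by rw [hd]; norm_num)]
  refine Multiset.eq_zero_of_forall_notMem fun p hp => ?_
  have h0 := (Polynomial.mem_roots'.1 hp).2
  rw [Polynomial.IsRoot, Polynomial.eval_add, Polynomial.eval_pow, Polynomial.eval_X,
    Polynomial.eval_C] at h0
  -- A root `p` would satisfy `p² = -q`; at the point `(1, …, 1)` the right side is `-m < 0`.
  have h1 := congrArg (eval (fun _ => (1 : ℝ))) h0
  simp only [hq, map_add, map_pow, map_sum, eval_X, one_pow, Finset.sum_const, Finset.card_univ,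
    Fintype.card_fin, nsmul_eq_mul, mul_one, map_zero] at h1
  have : (1 : ℝ) ≤ m := by exact_mod_cast hm
  nlinarith [sq_nonneg (eval (fun _ => (1 : ℝ)) p)]

theorem eval_smul_of_isHomogeneous {ι : Type*} {d : ℕ} {P : MvPolynomial ι ℝ}
    (hP : P.IsHomogeneous d) (c : ℝ) (x : ι → ℝ) :
    eval (fun j => c * x j) P = c ^ d * eval x P := by
  rw [eval_eq, eval_eq, Finset.mul_sum]
  refine Finset.sum_congr rfl fun s hs => ?_
  have hd : ∑ i ∈ s.support, s i = d := (hP.degree_eq_sum_deg_support hs).symm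
  simp_rw [mul_pow]
  rw [Finset.prod_mul_distrib, Finset.prod_pow_eq_pow_sum, hd]
  ring

/-- A homogeneous polynomial that vanishes on the unit sphere is zero. -/
theorem eq_zero_of_eval_sphere {m d : ℕ} {P : MvPolynomial (Fin (m + 1)) ℝ}
    (hP : P.IsHomogeneous d)
    (h : ∀ x : Sph m 1, eval (fun j => (x : EuclideanSpace ℝ (Fin (m + 1))) j) P = 0) :
    P = 0 := by
  refine MvPolynomial.funext fun y => ?_
  obtain ⟨x, c, hxc⟩ : ∃ (x : Sph m 1) (c : ℝ),
      WithLp.toLp 2 y = c • (x : EuclideanSpace ℝ (Fin (m + 1))) := by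
    by_cases hy : WithLp.toLp 2 y = 0
    · obtain ⟨x, hx⟩ := NormedSpace.sphere_nonempty (x := (0 : EuclideanSpace ℝ (Fin (m + 1))))
        (r := 1) |>.2 zero_le_one
      exact ⟨⟨x, hx⟩, 0, by rw [hy, zero_smul]⟩
    · refine ⟨⟨‖WithLp.toLp 2 y‖⁻¹ • WithLp.toLp 2 y, ?_⟩, ‖WithLp.toLp 2 y‖, ?_⟩
      · rw [mem_sphere_zero_iff_norm, norm_smul, norm_inv, norm_norm,
          inv_mul_cancel₀ (norm_ne_zero_iff.2 hy)]
      · rw [smul_smul, mul_inv_cancel₀ (norm_ne_zero_iff.2 hy), one_smul]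
  have hy : y = fun j => c * (x : EuclideanSpace ℝ (Fin (m + 1))) j :=
    _root_.funext fun j => congrArg (fun z : EuclideanSpace ℝ (Fin (m + 1)) => z j) hxc
  rw [hy, eval_smul_of_isHomogeneous hP, h, mul_zero, map_zero]

/-- Multiplication by a homogeneous polynomial shifts homogeneous components, so only the component
of `G` of degree `k - d` contributes. -/
theorem exists_isHomogeneous_of_mul {ι : Type*} {d k : ℕ} {Q G P : MvPolynomial ι ℝ}
    (hQ : Q.IsHomogeneous d) (hP : P.IsHomogeneous k) (h : P = Q * G) (hdk : d ≤ k) :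
    ∃ G' : MvPolynomial ι ℝ, G'.IsHomogeneous (k - d) ∧ P = Q * G' := by
  refine ⟨homogeneousComponent (k - d) G, homogeneousComponent_isHomogeneous _ _, ?_⟩
  let := MvPolynomial.gradedAlgebra (σ := ι) (R := ℝ)
  have h1 := DirectSum.coe_decompose_mul_add_of_left_mem (homogeneousSubmodule ι ℝ) (b := G)
    (j := k - d) hQ
  rw [Nat.add_sub_cancel' hdk, ← h] at h1
  have h2 : ∀ (p : MvPolynomial ι ℝ) (i : ℕ),
      (DirectSum.decompose (homogeneousSubmodule ι ℝ) p i : MvPolynomial ι ℝ)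
        = homogeneousComponent i p := fun p i => decomposition.decompose'_apply p i
  rw [h2, h2, homogeneousComponent_eq_self hP] at h1
  exact h1

/-- The quadric equals one on the sphere, so dividing it out of every component would give a form of
degree `k - 2` with the same restriction. -/
theorem exists_not_dvd {m n k : ℕ} {F : Fin (n + 1) → MvPolynomial (Fin (m + 1)) ℝ}
    (hF : IsFormOfMinimalDegree k F) (hF0 : F ≠ 0) : ∃ i, ¬ normSqPoly m ∣ F i := by
  by_contra! h
  choose G hG using h
  have hk : 2 ≤ k := by
    obtain ⟨i, hi⟩ := Function.ne_iff.1 hF0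
    have h1 := (hF.1 i).totalDegree hi
    have hi' : normSqPoly m * G i ≠ 0 := by rw [← hG]; exact hi
    rw [hG, totalDegree_mul_of_isDomain (left_ne_zero_of_mul hi') (right_ne_zero_of_mul hi'),
      (isHomogeneous_normSqPoly m).totalDegree (left_ne_zero_of_mul hi')] at h1
    omega
  choose G' hG' hFG using fun i =>
    exists_isHomogeneous_of_mul (isHomogeneous_normSqPoly m) (hF.1 i) (hG i) hk
  have := hF.2 (k - 2) G' hG' fun x => by
    ext i
    simp [evalForm, hFG, eval_normSqPoly]
  omega

/-- A form of degree `k - 2` that is parallel, on the sphere, to a form of minimal degree `k`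
vanishes. -/
theorem eq_zero_of_parallel {m n k : ℕ} (hm : 1 ≤ m)
    {F L : Fin (n + 1) → MvPolynomial (Fin (m + 1)) ℝ}
    (hF : IsFormOfMinimalDegree k F) (hF0 : F ≠ 0) (hk : k ≠ 0)
    (hL : ∀ i, (L i).IsHomogeneous (k - 1 - 1)) {c : ℝ} (hc : c ≠ 0)
    (h : ∀ (x : Sph m 1) (i), c * evalForm L x i = ⟪evalForm F x, evalForm L x⟫_ℝ * evalForm F x i) :
    L = 0 := by
  set A := ∑ j, L j * F j with hA
  have hAh : A.IsHomogeneous (k - 1 - 1 + k) :=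
    IsHomogeneous.sum _ _ _ fun j _ => (hL j).mul (hF.1 j)
  -- The power of the quadric is invisible on the sphere and equalizes the degrees, so the identity
  -- on the sphere becomes one of polynomials.
  have key : ∀ i, C c * (normSqPoly m ^ k * L i) = A * F i := fun i => by
    rw [← sub_eq_zero]
    refine eq_zero_of_eval_sphere (d := 2 * k + (k - 1 - 1)) (IsHomogeneous.sub
      ((((isHomogeneous_normSqPoly m).pow k).mul (hL i)).C_mul c) ?_) fun x => ?_
    · have := hAh.mul (hF.1 i)
      rwa [show k - 1 - 1 + k + k = 2 * k + (k - 1 - 1) by ring] at this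
    · have := h x i
      simp only [evalForm, PiLp.inner_apply, RCLike.inner_apply, conj_trivial] at this
      simp [eval_normSqPoly, hA, this]
  obtain ⟨i, hi⟩ := exists_not_dvd hF hF0
  have hQ := prime_normSqPoly hm
  -- Otherwise `A` is a nonzero multiple of the `k`-th power of the quadric, of degree at least `2 *
  -- k`. Its degree `(k - 1 - 1) + k` is smaller, also for `k = 1`, where the truncated subtraction
  -- gives `1 < 2`.
  have hA0 : A = 0 := by
    by_contra hA0
    obtain ⟨B, hB⟩ := hQ.pow_dvd_of_dvd_mul_right k hi
      (Dvd.intro (C c * L i) (by rw [← key]; ring))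
    have h1 := hAh.totalDegree hA0
    have hA0' := hA0
    rw [hB] at hA0'
    rw [hB, totalDegree_mul_of_isDomain (left_ne_zero_of_mul hA0') (right_ne_zero_of_mul hA0'),
      ((isHomogeneous_normSqPoly m).pow k).totalDegree (left_ne_zero_of_mul hA0')] at h1
    omega
  funext j
  have h2 := key j
  rw [hA0, zero_mul] at h2
  simpa [hc, pow_eq_zero_iff, hQ.ne_zero] using h2

end Algebra

/-! ### Splitting a trace into tangential and normal parts. -/

section Trace

variable {E G : Type*} [NormedAddCommGroup E] [InnerProductSpace ℝ E] [FiniteDimensional ℝ E]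
  [NormedAddCommGroup G] [NormedSpace ℝ G]

theorem finrank_tangent_add_one (x : sphere (0 : E) 1) :
    Module.finrank ℝ (tangent x) + 1 = Module.finrank ℝ E := by
  have hx : (x : E) ≠ 0 := norm_ne_zero_iff.1 (by simp [mem_sphere_zero_iff_norm.1 x.2])
  rw [← (Submodule.span ℝ {(x : E)}).finrank_add_finrank_orthogonal, finrank_span_singleton hx,
    add_comm]
  rfl

/-- The trace of a bilinear map is its trace on a hyperplane plus its value on a unit normal. -/
theorem sum_tangent_add {ι : Type*} [Fintype ι] (b : OrthonormalBasis ι ℝ E) (B : E →L[ℝ] E →L[ℝ] G)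
    (x : sphere (0 : E) 1) :
    ∑ i, B (stdOrthonormalBasis ℝ (tangent x) i : tangent x)
      (stdOrthonormalBasis ℝ (tangent x) i : tangent x) + B x x = ∑ j, B (b j) (b j) := by
  let v : Option (Fin (Module.finrank ℝ (tangent x))) → E := fun o =>
    o.elim (x : E) fun i => (stdOrthonormalBasis ℝ (tangent x) i : tangent x)
  have hv : Orthonormal ℝ v := by
    have h0 := (stdOrthonormalBasis ℝ (tangent x)).orthonormal
    refine ⟨?_, ?_⟩
    · rintro (_ | i)
      · exact mem_sphere_zero_iff_norm.1 x.2
      · exact h0.1 i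
    · rintro (_ | i) (_ | j) hij
      · exact absurd rfl hij
      · exact inner_basis x j
      · exact (real_inner_comm _ _).trans (inner_basis x i)
      · exact h0.2 fun h => hij (congrArg some h)
  have hs : ⊤ ≤ Submodule.span ℝ (Set.range v) :=
    (hv.linearIndependent.span_eq_top_of_card_eq_finrank' (by
      rw [Fintype.card_option, Fintype.card_fin, finrank_tangent_add_one])).ge
  -- The tensor `∑ eᵢ ⊗ eᵢ` is the same for all orthonormal bases; applying `B` to it gives basis
  -- independence of the trace.
  have h := congrArg (TensorProduct.lift B.toLinearMap₁₂)
    ((InnerProductSpace.canonicalCovariantTensor_eq_sum E (OrthonormalBasis.mk hv hs)).symm.trans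
      (InnerProductSpace.canonicalCovariantTensor_eq_sum E b))
  rw [map_sum, map_sum, Fintype.sum_option] at h
  simp only [TensorProduct.lift.tmul, OrthonormalBasis.coe_mk] at h
  rw [add_comm]
  exact h

end Trace

/-! ### Spherical Laplacian of a form; harmonic maps are eigenmaps. -/

section Forms

open MvPolynomial

variable {m n : ℕ}

local notation "V" k => EuclideanSpace ℝ (Fin (k + 1))

theorem hasFDerivAt_eval (P : MvPolynomial (Fin (m + 1)) ℝ) (x : V m) :
    HasFDerivAt (fun y : V m => eval (fun j => y j) P)
      (∑ j, eval (fun j => x j) (pderiv j P) •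
        (EuclideanSpace.proj j : (V m) →L[ℝ] ℝ)) x := by
  induction P using MvPolynomial.induction_on with
  | C a => simpa using hasFDerivAt_const a x
  | add p q hp hq => simpa [add_smul, Finset.sum_add_distrib] using hp.fun_add hq
  | mul_X p i hp =>
    have hi : HasFDerivAt (fun y : V m => y i) (EuclideanSpace.proj i : (V m) →L[ℝ] ℝ) x :=
      (EuclideanSpace.proj i : (V m) →L[ℝ] ℝ).hasFDerivAt
    simp only [map_mul, eval_X]
    refine (hp.mul hi).congr_fderiv ?_
    simp only [Derivation.leibniz, pderiv_X, smul_eq_mul, map_add, map_mul, eval_X, add_smul,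
      Finset.sum_add_distrib, Finset.smul_sum, smul_smul]
    congr 1
    rw [Finset.sum_eq_single i]
    · simp
    · intro j _ hj
      simp [hj.symm]
    · simp

theorem contDiff_evalForm (F : Fin (n + 1) → MvPolynomial (Fin (m + 1)) ℝ) :
    ContDiff ℝ ∞ (evalForm F) := by
  refine contDiff_euclidean.2 fun i => ?_
  change ContDiff ℝ ∞ fun y : V m => eval (fun j => y j) (F i)
  induction F i using MvPolynomial.induction_on with
  | C a => simpa using contDiff_const
  | add p q hp hq => simpa using hp.add hq
  | mul_X p i hp =>
    simpa using hp.mul (EuclideanSpace.proj i : (V m) →L[ℝ] ℝ).contDiff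

theorem fderiv_evalForm (F : Fin (n + 1) → MvPolynomial (Fin (m + 1)) ℝ) (x v : V m) :
    fderiv ℝ (evalForm F) x v = ∑ j, v j • evalForm (fun i => pderiv j (F i)) x := by
  ext i
  have h := ((EuclideanSpace.proj i : (V n) →L[ℝ] ℝ).hasFDerivAt.comp x
    ((contDiff_evalForm F).differentiable (by simp) x).hasFDerivAt).unique
    (hasFDerivAt_eval (F i) x)
  have h' := congrArg (fun A : (V m) →L[ℝ] ℝ => A v) h
  refine h'.trans ?_
  simp [evalForm, mul_comm]

theorem fderiv_evalForm_basis (F : Fin (n + 1) → MvPolynomial (Fin (m + 1)) ℝ) (x : V m)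
    (j : Fin (m + 1)) :
    fderiv ℝ (evalForm F) x (EuclideanSpace.basisFun (Fin (m + 1)) ℝ j)
      = evalForm (fun i => pderiv j (F i)) x := by
  rw [fderiv_evalForm, Finset.sum_eq_single j]
  · simp
  · intro l _ hl
    simp [hl]
  · simp

theorem fderiv_fderiv_apply {E G : Type*} [NormedAddCommGroup E] [NormedSpace ℝ E]
    [NormedAddCommGroup G] [NormedSpace ℝ G] {f : E → G} (hf : ContDiff ℝ ∞ f) (x u v : E) :
    fderiv ℝ (fun y => fderiv ℝ f y v) x u = fderiv ℝ (fderiv ℝ f) x u v := by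
  have h2 : ContDiff ℝ ∞ (fderiv ℝ f) := hf.fderiv_right (by simp)
  rw [fderiv_clm_apply (h2.differentiable (by simp) x) (differentiableAt_const v)]
  simp

theorem fderiv_fderiv_evalForm_basis (F : Fin (n + 1) → MvPolynomial (Fin (m + 1)) ℝ) (x : V m)
    (j : Fin (m + 1)) :
    fderiv ℝ (fderiv ℝ (evalForm F)) x (EuclideanSpace.basisFun (Fin (m + 1)) ℝ j)
      (EuclideanSpace.basisFun (Fin (m + 1)) ℝ j)
      = evalForm (fun i => pderiv j (pderiv j (F i))) x := by
  rw [← fderiv_fderiv_apply (contDiff_evalForm F),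
    _root_.funext fun y => fderiv_evalForm_basis F y j, fderiv_evalForm_basis]

theorem fderiv_evalForm_self {k : ℕ} {F : Fin (n + 1) → MvPolynomial (Fin (m + 1)) ℝ}
    (hF : IsForm k F) (x : V m) : fderiv ℝ (evalForm F) x x = (k : ℝ) • evalForm F x := by
  rw [fderiv_evalForm]
  ext i
  have h := congrArg (eval fun j => x j) (hF i).sum_X_mul_pderiv
  simpa [evalForm] using h

/-- Differentiating Euler's identity `df_x(x) = k f(x)` in the direction `x` gives `D²f(x, x) + k f
= k² f`. -/
theorem fderiv_fderiv_evalForm_self {k : ℕ} {F : Fin (n + 1) → MvPolynomial (Fin (m + 1)) ℝ}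
    (hF : IsForm k F) (x : V m) :
    fderiv ℝ (fderiv ℝ (evalForm F)) x x x = ((k : ℝ) * (k - 1)) • evalForm F x := by
  have hf := contDiff_evalForm F
  have h2 : ContDiff ℝ ∞ (fderiv ℝ (evalForm F)) := hf.fderiv_right (by simp)
  have h := (h2.differentiable (by simp) x).hasFDerivAt.clm_apply (hasFDerivAt_id (𝕜 := ℝ) x)
  have e : (fun y => fderiv ℝ (evalForm F) y (id y)) = (k : ℝ) • evalForm F :=
    _root_.funext fun y => fderiv_evalForm_self hF y
  rw [e] at h
  have h' := congrArg (fun A : (V m) →L[ℝ] (V n) => A x)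
    (h.unique ((hf.differentiable (by simp) x).hasFDerivAt.const_smul (k : ℝ)))
  simp only [add_apply, ContinuousLinearMap.comp_apply, smul_apply,
    ContinuousLinearMap.flip_apply, id, ContinuousLinearMap.id_apply, fderiv_evalForm_self hF] at h'
  rw [eq_sub_of_add_eq' h']
  module

/-- The Euclidean Laplacian of a tuple of polynomials. -/
def lapForm (F : Fin (n + 1) → MvPolynomial (Fin (m + 1)) ℝ) :
    Fin (n + 1) → MvPolynomial (Fin (m + 1)) ℝ := fun i => ∑ j, pderiv j (pderiv j (F i))

/-- The eigenvalue of the Laplacian of the unit sphere on spherical harmonics of degree `k`. -/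
def sphEigenvalue (m k : ℕ) : ℝ := k * (k + m - 1)

/-- The tangential trace of `D²f` omits the normal term `k (k - 1) f`, and each of the `m` tangent
directions subtracts `df_x(x) = k f`; together this is `k (k + m - 1) f`. -/
theorem sphLaplacian_evalForm {k : ℕ} {F : Fin (n + 1) → MvPolynomial (Fin (m + 1)) ℝ}
    (hF : IsForm k F) (x : Sph m 1) :
    sphLaplacian (evalForm F) x
      = evalForm (lapForm F) x - sphEigenvalue m k • evalForm F x := by
  have h1 := sum_tangent_add (EuclideanSpace.basisFun (Fin (m + 1)) ℝ)
    (fderiv ℝ (fderiv ℝ (evalForm F)) x) x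
  have h2 : evalForm (lapForm F) x
      = ∑ j, evalForm (fun i => pderiv j (pderiv j (F i))) x := by
    ext i
    simp [evalForm, lapForm]
  have hd : Module.finrank ℝ (tangent x) = m := by
    have := finrank_tangent_add_one x
    rw [finrank_euclideanSpace_fin] at this
    omega
  rw [Finset.sum_congr rfl fun j _ => fderiv_fderiv_evalForm_basis F x j, ← h2,
    fderiv_fderiv_evalForm_self hF] at h1
  rw [sphLaplacian, Finset.sum_sub_distrib, eq_sub_of_add_eq h1, fderiv_evalForm_self hF,
    Finset.sum_const, Finset.card_univ, Fintype.card_fin, hd, sphEigenvalue, ← Nat.cast_smul_eq_nsmul ℝ]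
  module

/-- A harmonic map between spheres that is the restriction of a form of minimal degree is the
restriction of a form with harmonic components. -/
theorem lapForm_eq_zero {r : ℝ} (hm : 1 ≤ m) (hr : 0 < r) {k : ℕ}
    {F : Fin (n + 1) → MvPolynomial (Fin (m + 1)) ℝ} (hF : IsFormOfMinimalDegree k F)
    {φ : Sph m 1 → Sph n r} (hφ : RestrictsTo F φ) (hh : IsHarmonic φ) : lapForm F = 0 := by
  -- Constants are separate: the degree comparison in `eq_zero_of_parallel` needs `k ≥ 1`.
  rcases eq_or_ne k 0 with rfl | hk
  · funext i
    have h := totalDegree_eq_zero_iff_eq_C.1 ((totalDegree_zero_iff_isHomogeneous _).2 (hF.1 i))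
    rw [lapForm, h]
    simp
  refine eq_zero_of_parallel hm hF ?_ hk
    (fun i => IsHomogeneous.sum _ _ _ fun j _ => (hF.1 i).pderiv.pderiv)
    (pow_ne_zero 2 hr.ne') fun x i => ?_
  · rintro rfl
    obtain ⟨x, hx⟩ := NormedSpace.sphere_nonempty (x := (0 : V m)) (r := 1) |>.2 zero_le_one
    have h1 := mem_sphere_zero_iff_norm.1 (φ ⟨x, hx⟩).2
    rw [← hφ ⟨x, hx⟩, show evalForm (0 : Fin (n + 1) → MvPolynomial (Fin (m + 1)) ℝ) x = 0 by
      ext; simp [evalForm], norm_zero] at h1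
    exact hr.ne h1
  · have h := hh.2 x
    rw [tension_eq (fun y => (hφ y).symm) (contDiff_evalForm F), sphLaplacian_evalForm hF.1,
      tanProj_sub, tanProj_smul, hφ x, tanProj_self hr.ne', smul_zero, sub_zero, tanProj_eq,
      sub_eq_zero] at h
    have hi := congrArg (fun z : V n => z i) h
    simp only [PiLp.smul_apply, smul_eq_mul] at hi
    rw [hi, hφ x]
    field_simp

theorem sphLaplacian_of_isHarmonic {r : ℝ} (hm : 1 ≤ m) (hr : 0 < r) {k : ℕ}
    {F : Fin (n + 1) → MvPolynomial (Fin (m + 1)) ℝ} (hF : IsFormOfMinimalDegree k F)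
    {φ : Sph m 1 → Sph n r} (hφ : RestrictsTo F φ) (hh : IsHarmonic φ) (x : Sph m 1) :
    sphLaplacian (evalForm F) x = -sphEigenvalue m k • evalForm F x := by
  rw [sphLaplacian_evalForm hF.1, lapForm_eq_zero hm hr hF hφ hh, neg_smul,
    show evalForm (0 : Fin (n + 1) → MvPolynomial (Fin (m + 1)) ℝ) x = 0 by
      ext; simp [evalForm], zero_sub]

theorem sphEigenvalue_injective (hm : 1 ≤ m) : Function.Injective (sphEigenvalue m) := by
  intro k l h
  have hm' : (1 : ℝ) ≤ m := by exact_mod_cast hm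
  have h' : ((k : ℝ) - l) * (k + l + (m - 1)) = 0 := by
    simp only [sphEigenvalue] at h
    linear_combination h
  rcases mul_eq_zero.1 h' with h1 | h1
  · exact_mod_cast sub_eq_zero.1 h1
  -- Here a sum of nonnegative terms `k + l + (m - 1)` vanishes, which forces `k = l = 0`.
  · have hk : (0 : ℝ) ≤ k := k.cast_nonneg
    have hl : (0 : ℝ) ≤ l := l.cast_nonneg
    have hk0 : (k : ℝ) = 0 := by linarith
    have hl0 : (l : ℝ) = 0 := by linarith
    exact_mod_cast hk0.trans hl0.symm

end Forms

/-! ### The diagonal map and the sections `(a φ₁, b φ₂)`. -/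

section Diagonal

variable {E F F₁ F₂ G H : Type*}
  [NormedAddCommGroup E] [InnerProductSpace ℝ E]
  [NormedAddCommGroup F] [InnerProductSpace ℝ F]
  [NormedAddCommGroup F₁] [InnerProductSpace ℝ F₁]
  [NormedAddCommGroup F₂] [InnerProductSpace ℝ F₂]
  [NormedAddCommGroup G] [NormedSpace ℝ G]
  [NormedAddCommGroup H] [NormedSpace ℝ H]
  {r r₁ r₂ : ℝ}

/-- Differentiate `‖f‖² = r²`. This holds only on the sphere, hence the tangent direction and the
passage through `sphDeriv`. -/
theorem inner_fderiv_eq_zero {φ : sphere (0 : E) 1 → sphere (0 : F) r} {f : E → F}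
    (hφ : ∀ y : sphere (0 : E) 1, f y = φ y) (hf : ContDiff ℝ ∞ f) (x : sphere (0 : E) 1) {e : E}
    (he : ⟪(x : E), e⟫_ℝ = 0) : ⟪f x, fderiv ℝ f x e⟫_ℝ = 0 := by
  have hfx := (hf.differentiable (by simp) (x : E)).hasFDerivAt
  have h := hfx.inner ℝ hfx
  have h1 : ∀ c : ℝ, sphDeriv (fun _ : sphere (0 : E) 1 => c) x e = 0 := fun c => by
    rw [sphDeriv_eq_fderiv (g := fun _ => c) (fun _ => rfl) (differentiableAt_const c) he]
    simp
  have h2 := h1 (r ^ 2)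
  rw [sphDeriv_eq_fderiv (g := fun y => ⟪f y, f y⟫_ℝ) (fun y => by
    rw [hφ, real_inner_self_eq_norm_sq, mem_sphere_zero_iff_norm.1 (φ y).2])
    h.differentiableAt he, h.fderiv] at h2
  simp only [ContinuousLinearMap.comp_apply, ContinuousLinearMap.prod_apply, fderivInnerCLM_apply,
    real_inner_comm (f x)] at h2
  linarith

theorem fderiv_clm_comp (A : G →L[ℝ] H) {f : E → G} (hf : ContDiff ℝ ∞ f) (y v : E) :
    fderiv ℝ (fun y => A (f y)) y v = A (fderiv ℝ f y v) := by
  have h := A.hasFDerivAt.comp y (hf.differentiable (by simp) y).hasFDerivAt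
  exact congrArg (fun B : E →L[ℝ] H => B v) h.fderiv

/-- The map `(a f₁, b f₂)` into the Euclidean product. -/
def scaledPair {X : Type*} (f₁ : X → F₁) (f₂ : X → F₂) (a b : ℝ) (y : X) : WithLp 2 (F₁ × F₂) :=
  WithLp.toLp 2 (a • f₁ y, b • f₂ y)

variable {f₁ : E → F₁} {f₂ : E → F₂}

theorem contDiff_scaledPair (hf₁ : ContDiff ℝ ∞ f₁) (hf₂ : ContDiff ℝ ∞ f₂) (a b : ℝ) :
    ContDiff ℝ ∞ (scaledPair f₁ f₂ a b) :=
  (WithLp.prodContinuousLinearEquiv 2 ℝ F₁ F₂).symm.contDiff.comp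
    ((contDiff_const.smul hf₁).prodMk (contDiff_const.smul hf₂))

theorem fderiv_scaledPair (hf₁ : ContDiff ℝ ∞ f₁) (hf₂ : ContDiff ℝ ∞ f₂) (a b : ℝ) (x v : E) :
    fderiv ℝ (scaledPair f₁ f₂ a b) x v
      = WithLp.toLp 2 (a • fderiv ℝ f₁ x v, b • fderiv ℝ f₂ x v) := by
  have h := (WithLp.prodContinuousLinearEquiv 2 ℝ F₁ F₂).symm.hasFDerivAt.comp x
    (((hf₁.differentiable (by simp) x).hasFDerivAt.const_smul a).prodMk
      ((hf₂.differentiable (by simp) x).hasFDerivAt.const_smul b))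
  exact congrArg (fun B : E →L[ℝ] WithLp 2 (F₁ × F₂) => B v) h.fderiv

theorem scaledPair_sub {X : Type*} {f₁ : X → F₁} {f₂ : X → F₂} (a b c d : ℝ) (x : X) :
    scaledPair f₁ f₂ a b x - scaledPair f₁ f₂ c d x = scaledPair f₁ f₂ (a - c) (b - d) x := by
  simp only [scaledPair, sub_smul]
  rfl

theorem scaledPair_smul {X : Type*} {f₁ : X → F₁} {f₂ : X → F₂} (c a b : ℝ) (x : X) :
    c • scaledPair f₁ f₂ a b x = scaledPair f₁ f₂ (c * a) (c * b) x := by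
  simp only [scaledPair, mul_smul]
  rfl

variable {φ₁ : sphere (0 : E) 1 → sphere (0 : F₁) r₁} {φ₂ : sphere (0 : E) 1 → sphere (0 : F₂) r₂}

theorem inner_scaledPair (hφ₁ : ∀ y : sphere (0 : E) 1, f₁ y = φ₁ y)
    (hφ₂ : ∀ y : sphere (0 : E) 1, f₂ y = φ₂ y) (a b c d : ℝ)
    (x : sphere (0 : E) 1) :
    ⟪scaledPair f₁ f₂ a b x, scaledPair f₁ f₂ c d x⟫_ℝ = a * c * r₁ ^ 2 + b * d * r₂ ^ 2 := by
  rw [scaledPair, scaledPair, WithLp.prod_inner_apply]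
  simp only [real_inner_smul_left, real_inner_smul_right, real_inner_self_eq_norm_sq, hφ₁, hφ₂,
    mem_sphere_zero_iff_norm.1 (φ₁ x).2, mem_sphere_zero_iff_norm.1 (φ₂ x).2]
  ring

theorem inner_scaledPair_fderiv (hφ₁ : ∀ y : sphere (0 : E) 1, f₁ y = φ₁ y)
    (hφ₂ : ∀ y : sphere (0 : E) 1, f₂ y = φ₂ y)
    (hf₁ : ContDiff ℝ ∞ f₁) (hf₂ : ContDiff ℝ ∞ f₂) (a b c d : ℝ) (x : sphere (0 : E) 1) {e : E}
    (he : ⟪(x : E), e⟫_ℝ = 0) :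
    ⟪scaledPair f₁ f₂ a b x, fderiv ℝ (scaledPair f₁ f₂ c d) x e⟫_ℝ = 0 := by
  rw [fderiv_scaledPair hf₁ hf₂, scaledPair, WithLp.prod_inner_apply]
  simp [real_inner_smul_left, real_inner_smul_right, inner_fderiv_eq_zero hφ₁ hf₁ x he,
    inner_fderiv_eq_zero hφ₂ hf₂ x he]

theorem scaledPair_eq_zero_iff (hφ₁ : ∀ y : sphere (0 : E) 1, f₁ y = φ₁ y)
    (hφ₂ : ∀ y : sphere (0 : E) 1, f₂ y = φ₂ y) (hr₁ : r₁ ≠ 0)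
    (hr₂ : r₂ ≠ 0) (a b : ℝ) (x : sphere (0 : E) 1) :
    scaledPair f₁ f₂ a b x = 0 ↔ a = 0 ∧ b = 0 := by
  rw [← inner_self_eq_zero (𝕜 := ℝ), inner_scaledPair hφ₁ hφ₂]
  constructor
  · intro h
    have h1 : (a * r₁) ^ 2 = 0 := by nlinarith [sq_nonneg (a * r₁), sq_nonneg (b * r₂)]
    have h2 : (b * r₂) ^ 2 = 0 := by nlinarith [sq_nonneg (a * r₁), sq_nonneg (b * r₂)]
    exact ⟨(mul_eq_zero.1 (pow_eq_zero_iff two_ne_zero |>.1 h1)).resolve_right hr₁,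
      (mul_eq_zero.1 (pow_eq_zero_iff two_ne_zero |>.1 h2)).resolve_right hr₂⟩
  · rintro ⟨rfl, rfl⟩
    simp

variable (hr : r₁ ^ 2 + r₂ ^ 2 = 1)

theorem diagonalMap_eq_scaledPair (hφ₁ : ∀ y : sphere (0 : E) 1, f₁ y = φ₁ y)
    (hφ₂ : ∀ y : sphere (0 : E) 1, f₂ y = φ₂ y)
    (y : sphere (0 : E) 1) :
    (diagonalMap hr φ₁ φ₂ y : WithLp 2 (F₁ × F₂)) = scaledPair f₁ f₂ 1 1 y := by
  rw [scaledPair, one_smul, one_smul, hφ₁, hφ₂]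
  rfl

/-- The normal coefficient is `a r₁² + b r₂²`; since `r₁² + r₂² = 1`, subtracting it from `a` leaves
`(a - b) r₂²`, and similarly for `b`. -/
theorem tanProj_scaledPair (hφ₁ : ∀ y : sphere (0 : E) 1, f₁ y = φ₁ y)
    (hφ₂ : ∀ y : sphere (0 : E) 1, f₂ y = φ₂ y) (a b : ℝ)
    (x : sphere (0 : E) 1) :
    tanProj (diagonalMap hr φ₁ φ₂ x) (scaledPair f₁ f₂ a b x)
      = scaledPair f₁ f₂ ((a - b) * r₂ ^ 2) (-((a - b) * r₁ ^ 2)) x := by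
  rw [tanProj_eq, diagonalMap_eq_scaledPair hr hφ₁ hφ₂, inner_scaledPair hφ₁ hφ₂, scaledPair_smul,
    scaledPair_sub]
  congr 1
  · linear_combination -a * hr
  · linear_combination -b * hr

theorem isSmooth_diagonalMap (h₁ : IsSmooth fun y => (φ₁ y : F₁))
    (h₂ : IsSmooth fun y => (φ₂ y : F₂)) :
    IsSmooth fun y => (diagonalMap hr φ₁ φ₂ y : WithLp 2 (F₁ × F₂)) := by
  refine ((WithLp.prodContinuousLinearEquiv 2 ℝ F₁ F₂).symm.contDiff.comp_contDiffOn
    (h₁.prodMk h₂)).congr fun y _ => ?_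
  by_cases h : (1 / ‖y‖) • y ∈ sphere (0 : E) 1
  · simp only [radialExt, dif_pos h, Function.comp_apply]
    rfl
  -- Both sides take the default value zero.
  · simp only [radialExt, dif_neg h, Function.comp_apply]
    rfl

variable [FiniteDimensional ℝ E]

/-- The energy density of a map between spheres. -/
theorem sum_inner_fderiv {φ : sphere (0 : E) 1 → sphere (0 : F) r} {f : E → F}
    (hφ : ∀ y : sphere (0 : E) 1, f y = φ y) (hf : ContDiff ℝ ∞ f) (x : sphere (0 : E) 1) :
    ∑ i, ⟪fderiv ℝ f x (stdOrthonormalBasis ℝ (tangent x) i : tangent x),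
      fderiv ℝ f x (stdOrthonormalBasis ℝ (tangent x) i : tangent x)⟫_ℝ
      = -⟪f x, sphLaplacian f x⟫_ℝ := by
  rw [sphLaplacian, inner_sum, ← Finset.sum_neg_distrib]
  refine Finset.sum_congr rfl fun i _ => ?_
  have he := inner_basis x i
  have he1 := norm_basis x i
  set e : E := ((stdOrthonormalBasis ℝ (tangent x) i : tangent x) : E)
  have hfx := (hf.differentiable (by simp) (x : E)).hasFDerivAt
  -- Differentiating `⟨f, df(tanField e)⟩ = 0` along `e` yields `‖df(e)‖² + ⟨f, D²f(e, e) - df(x)⟩ =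
  -- 0`.
  have h := hfx.inner ℝ (hasFDerivAt_fderiv_tanField hf e (x : E))
  have h2 : sphDeriv (fun _ : sphere (0 : E) 1 => (0 : ℝ)) x e = 0 := by
    rw [sphDeriv_eq_fderiv (g := fun _ => (0 : ℝ)) (fun _ => rfl) (differentiableAt_const _) he]
    simp
  rw [sphDeriv_eq_fderiv (g := fun y => ⟪f y, fderiv ℝ f y (e - ⟪y, e⟫_ℝ • y)⟫_ℝ) (fun y => by
    rw [← tanField_eq, inner_fderiv_eq_zero hφ hf y (inner_tanField e y)])
    h.differentiableAt he, h.fderiv] at h2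
  simp [he, he1, inner_add_right, inner_neg_right] at h2
  rw [inner_sub_right, real_inner_self_eq_norm_sq]
  linarith

/-- Applied to coordinate projections and scalar multiples, this computes the Laplacian of a pair
componentwise. -/
theorem sphLaplacian_clm_comp (A : G →L[ℝ] H) {f : E → G} (hf : ContDiff ℝ ∞ f)
    (x : sphere (0 : E) 1) : sphLaplacian (fun y => A (f y)) x = A (sphLaplacian f x) := by
  have hAf : ContDiff ℝ ∞ (fun y => A (f y)) := A.contDiff.comp hf
  have h2 : ContDiff ℝ ∞ (fderiv ℝ f) := hf.fderiv_right (by simp)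
  rw [sphLaplacian, sphLaplacian, map_sum]
  refine Finset.sum_congr rfl fun i _ => ?_
  rw [map_sub, fderiv_clm_comp A hf, ← fderiv_fderiv_apply hAf, ← fderiv_fderiv_apply hf]
  simp only [fderiv_clm_comp A hf]
  rw [fderiv_clm_comp A (h2.clm_apply contDiff_const)]

variable {l₁ l₂ : ℝ}

theorem sphLaplacian_scaledPair (hf₁ : ContDiff ℝ ∞ f₁) (hf₂ : ContDiff ℝ ∞ f₂) (a b : ℝ) {x : sphere (0 : E) 1} (h₁ : sphLaplacian f₁ x = -l₁ • f₁ x)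
    (h₂ : sphLaplacian f₂ x = -l₂ • f₂ x) :
    sphLaplacian (scaledPair f₁ f₂ a b) x = scaledPair f₁ f₂ (-(a * l₁)) (-(b * l₂)) x := by
  have hs := contDiff_scaledPair hf₁ hf₂ a b
  let e := WithLp.prodContinuousLinearEquiv 2 ℝ F₁ F₂
  refine e.injective (Prod.ext ?_ ?_)
  · have h := sphLaplacian_clm_comp ((ContinuousLinearMap.fst ℝ F₁ F₂).comp (e : _ →L[ℝ] _)) hs x
    have h' := sphLaplacian_clm_comp (a • ContinuousLinearMap.id ℝ F₁) hf₁ x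
    refine (h.symm.trans h').trans ?_
    rw [h₁]
    change a • -l₁ • f₁ x = -(a * l₁) • f₁ x
    module
  · have h := sphLaplacian_clm_comp ((ContinuousLinearMap.snd ℝ F₁ F₂).comp (e : _ →L[ℝ] _)) hs x
    have h' := sphLaplacian_clm_comp (b • ContinuousLinearMap.id ℝ F₂) hf₂ x
    refine (h.symm.trans h').trans ?_
    rw [h₂]
    change b • -l₂ • f₂ x = -(b * l₂) • f₂ x
    module

theorem tension_diagonalMap (hφ₁ : ∀ y : sphere (0 : E) 1, f₁ y = φ₁ y)
    (hφ₂ : ∀ y : sphere (0 : E) 1, f₂ y = φ₂ y)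
    (hf₁ : ContDiff ℝ ∞ f₁) (hf₂ : ContDiff ℝ ∞ f₂) {x : sphere (0 : E) 1}
    (h₁ : sphLaplacian f₁ x = -l₁ • f₁ x) (h₂ : sphLaplacian f₂ x = -l₂ • f₂ x) :
    tension (F := WithLp 2 (F₁ × F₂)) (diagonalMap hr φ₁ φ₂) x
      = scaledPair f₁ f₂ ((l₂ - l₁) * r₂ ^ 2) (-((l₂ - l₁) * r₁ ^ 2)) x := by
  rw [tension_eq (F := WithLp 2 (F₁ × F₂)) (diagonalMap_eq_scaledPair hr hφ₁ hφ₂) (contDiff_scaledPair hf₁ hf₂ 1 1),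
    sphLaplacian_scaledPair hf₁ hf₂ 1 1 h₁ h₂, tanProj_scaledPair hr hφ₁ hφ₂]
  congr 1 <;> ring

theorem bitension_diagonalMap (hφ₁ : ∀ y : sphere (0 : E) 1, f₁ y = φ₁ y)
    (hφ₂ : ∀ y : sphere (0 : E) 1, f₂ y = φ₂ y)
    (hf₁ : ContDiff ℝ ∞ f₁) (hf₂ : ContDiff ℝ ∞ f₂)
    (h₁ : ∀ x : sphere (0 : E) 1, sphLaplacian f₁ x = -l₁ • f₁ x)
    (h₂ : ∀ x : sphere (0 : E) 1, sphLaplacian f₂ x = -l₂ • f₂ x) (x : sphere (0 : E) 1) :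
    bitension (F := WithLp 2 (F₁ × F₂)) (diagonalMap hr φ₁ φ₂) x
      = scaledPair f₁ f₂ ((l₂ - l₁) ^ 2 * (1 - 2 * r₁ ^ 2) * r₂ ^ 2)
        (-((l₂ - l₁) ^ 2 * (1 - 2 * r₁ ^ 2) * r₁ ^ 2)) x := by
  have hφ := diagonalMap_eq_scaledPair hr hφ₁ hφ₂
  have hf := contDiff_scaledPair hf₁ hf₂ 1 1
  have hτ := fun y => tension_diagonalMap hr hφ₁ hφ₂ hf₁ hf₂ (h₁ y) (h₂ y)
  -- The tension field is a pair `(a φ₁, b φ₂)`, hence orthogonal to `dφ(e)`, and one of the two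
  -- terms of the constant curvature tensor drops out.
  have hc : ∀ i, curvature (F := WithLp 2 (F₁ × F₂)) (diagonalMap hr φ₁ φ₂ x) (pushField (F := WithLp 2 (F₁ × F₂)) (diagonalMap hr φ₁ φ₂) (frame x i) x)
      (tension (F := WithLp 2 (F₁ × F₂)) (diagonalMap hr φ₁ φ₂) x) (pushField (F := WithLp 2 (F₁ × F₂)) (diagonalMap hr φ₁ φ₂) (frame x i) x)
      = -⟪fderiv ℝ (scaledPair f₁ f₂ 1 1) x (stdOrthonormalBasis ℝ (tangent x) i : tangent x),
          fderiv ℝ (scaledPair f₁ f₂ 1 1) x (stdOrthonormalBasis ℝ (tangent x) i : tangent x)⟫_ℝ •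
        tension (F := WithLp 2 (F₁ × F₂)) (diagonalMap hr φ₁ φ₂) x := fun i => by
    have ho := fun a b : ℝ =>
      inner_scaledPair_fderiv hφ₁ hφ₂ hf₁ hf₂ a b 1 1 x (inner_basis x i)
    rw [pushField_frame hφ hf, curvature_eq]
    · rw [hτ, ho, zero_smul, zero_sub, neg_smul]
    · rw [hφ, ho]
    · rw [hτ, hφ, inner_scaledPair hφ₁ hφ₂]
      ring
    · rw [hφ, ho]
  -- The curvature trace contributes `(l₁ r₁² + l₂ r₂²) τ` and the Laplacian `-(l₁ r₂² + l₂ r₁²) τ`;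
  -- the difference of the factors is `(l₂ - l₁) (r₂² - r₁²)`.
  rw [bitension, Finset.sum_congr rfl fun i _ => hc i, ← Finset.sum_smul, Finset.sum_neg_distrib,
    sum_inner_fderiv (fun y => (hφ y).symm) hf, sphLaplacian_scaledPair hf₁ hf₂ 1 1 (h₁ x) (h₂ x),
    inner_scaledPair hφ₁ hφ₂,
    roughLaplacian_eq one_ne_zero hφ hf hτ (contDiff_scaledPair hf₁ hf₂ _ _) x fun e he =>
      inner_scaledPair_fderiv hφ₁ hφ₂ hf₁ hf₂ _ _ _ _ x he,
    sphLaplacian_scaledPair hf₁ hf₂ _ _ (h₁ x) (h₂ x), tanProj_scaledPair hr hφ₁ hφ₂, neg_neg, hτ,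
    scaledPair_smul, scaledPair_sub]
  have hr' : r₂ ^ 2 = 1 - r₁ ^ 2 := by linear_combination hr
  rw [hr']
  congr 1 <;> ring

theorem isProperBiharmonic_diagonalMap_iff [Nonempty (sphere (0 : E) 1)] (hr₁ : r₁ ≠ 0)
    (hr₂ : r₂ ≠ 0) (hφ₁ : ∀ y : sphere (0 : E) 1, f₁ y = φ₁ y)
    (hφ₂ : ∀ y : sphere (0 : E) 1, f₂ y = φ₂ y)
    (hf₁ : ContDiff ℝ ∞ f₁) (hf₂ : ContDiff ℝ ∞ f₂)
    (hs₁ : IsSmooth fun y => (φ₁ y : F₁)) (hs₂ : IsSmooth fun y => (φ₂ y : F₂))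
    (h₁ : ∀ x : sphere (0 : E) 1, sphLaplacian f₁ x = -l₁ • f₁ x)
    (h₂ : ∀ x : sphere (0 : E) 1, sphLaplacian f₂ x = -l₂ • f₂ x) :
    IsProperBiharmonic (F := WithLp 2 (F₁ × F₂)) (diagonalMap hr φ₁ φ₂) ↔ l₁ ≠ l₂ ∧ 1 - 2 * r₁ ^ 2 = 0 := by
  have hs := isSmooth_diagonalMap hr hs₁ hs₂
  have hz := fun a b x => scaledPair_eq_zero_iff hφ₁ hφ₂ hr₁ hr₂ a b x
  have hτ : IsHarmonic (F := WithLp 2 (F₁ × F₂)) (diagonalMap hr φ₁ φ₂) ↔ l₁ = l₂ := by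
    simp only [IsHarmonic, hs, true_and,
      fun x => tension_diagonalMap hr hφ₁ hφ₂ hf₁ hf₂ (h₁ x) (h₂ x), hz]
    simp [hr₁, hr₂, sub_eq_zero, eq_comm]
  have hτ₂ : IsBiharmonic (F := WithLp 2 (F₁ × F₂)) (diagonalMap hr φ₁ φ₂) ↔ l₁ = l₂ ∨ 1 - 2 * r₁ ^ 2 = 0 := by
    simp only [IsBiharmonic, hs, true_and,
      bitension_diagonalMap hr hφ₁ hφ₂ hf₁ hf₂ h₁ h₂, hz]
    simp [hr₁, hr₂, sub_eq_zero, eq_comm]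
  rw [IsProperBiharmonic, hτ, hτ₂]
  tauto

end Diagonal

end SphereMaps

end

theorem mainTheorem9 (m n₁ n₂ k₁ k₂ : ℕ) (hm : 1 ≤ m) (r₁ r₂ : ℝ) (hr₁ : 0 < r₁) (hr₂ : 0 < r₂)
    (hr : r₁ ^ 2 + r₂ ^ 2 = 1)
    (F₁ : Fin (n₁ + 1) → MvPolynomial (Fin (m + 1)) ℝ)
    (F₂ : Fin (n₂ + 1) → MvPolynomial (Fin (m + 1)) ℝ)
    (hF₁ : SphereMaps.IsFormOfMinimalDegree k₁ F₁)
    (hF₂ : SphereMaps.IsFormOfMinimalDegree k₂ F₂)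
    (φ₁ : SphereMaps.Sph m 1 → SphereMaps.Sph n₁ r₁)
    (φ₂ : SphereMaps.Sph m 1 → SphereMaps.Sph n₂ r₂)
    (hφ₁ : SphereMaps.RestrictsTo F₁ φ₁)
    (hφ₂ : SphereMaps.RestrictsTo F₂ φ₂)
    (hh₁ : SphereMaps.IsHarmonic φ₁)
    (hh₂ : SphereMaps.IsHarmonic φ₂) :
    SphereMaps.IsProperBiharmonic (SphereMaps.diagonalMap hr φ₁ φ₂) ↔
      k₁ ≠ k₂ ∧ r₁ = 1 / √2 ∧ r₂ = 1 / √2 := by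
  have : Nonempty (SphereMaps.Sph m 1) :=
    (NormedSpace.sphere_nonempty.2 zero_le_one).to_subtype
  rw [SphereMaps.isProperBiharmonic_diagonalMap_iff hr hr₁.ne' hr₂.ne' hφ₁ hφ₂
    (SphereMaps.contDiff_evalForm F₁) (SphereMaps.contDiff_evalForm F₂) hh₁.1 hh₂.1
    (SphereMaps.sphLaplacian_of_isHarmonic hm hr₁ hF₁ hφ₁ hh₁)
    (SphereMaps.sphLaplacian_of_isHarmonic hm hr₂ hF₂ hφ₂ hh₂),
    (SphereMaps.sphEigenvalue_injective hm).ne_iff]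
  have h2 : (1 / √2) ^ 2 = (1 / 2 : ℝ) := by rw [div_pow, one_pow, Real.sq_sqrt zero_le_two]
  have h0 : (0 : ℝ) ≤ 1 / √2 := by positivity
  refine and_congr_right fun _ => ⟨fun h => ?_, fun h => ?_⟩
  -- Both squares equal `1/2`, the second by `hr`, and positivity selects the root.
  · exact ⟨(sq_eq_sq₀ hr₁.le h0).1 (by linarith), (sq_eq_sq₀ hr₂.le h0).1 (by linarith)⟩
  · rw [h.1, h2]
    norm_num
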